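/- Let $Q\in\mathbb{R}^{n\times n}$ be symmetric positive semidefinite, let $c,a,\ell,u\in\mathbb{R}^n$ with $\ell_i<u_i$ for all $i$, let $d\in\mathbb{R}$, and put $C:=\{x\in\mathbb{R}^n : a^Tx=d,\ \ell\le x\le u\}$. Let $\delta_C$ be the indicator function of $C$ ($0$ on $C$ and $+\infty$ elsewhere) and $\delta_C^*(z)=\sup_{y}\{\langle z,y\rangle-\delta_C(y)\}$ its conjugate. Define $$f(x):=\tfrac12\langle x,Qx\rangle+\langle c,x\rangle+\delta_C(x),\qquad l(w,z,x):=\begin{cases}\tfrac12\langle w,Qw\rangle+\delta_C^*(z)-\langle x,Qw+z+c\rangle, & w\in\mathrm{Ran}(Q),\\ +\infty, & \text{otherwise,}\end{cases}$$ for $w,z,x\in\mathbb{R}^n$. Here $f$ is convex and $l$ is the Lagrangian, convex in $(w,z)$ and concave in $x$, of the restricted dual problem $\min\{\tfrac12\langle w,Qw\rangle+\delta_C^*(z) : Qw+z+c=0,\ w\in\mathrm{Ran}(Q)\}$. Let $T_f(x):=\partial f(x)$ (the convex subdifferential) and $$T_l(w,z,x):=\{(u_w,u_z,u_x)\in\mathbb{R}^{3n}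 : (u_w,u_z,-u_x)\in\partial l(w,z,x)\},$$ where $\partial l(w,z,x)$ is the subdifferential of the convex-concave function $l$: it consists of all $(v_w,v_z,v_x)$ such that $(v_w,v_z)$ is a subgradient of $l(\cdot,\cdot,x)$ at $(w,z)$ and $v_x$ is a supergradient of $l(w,z,\cdot)$ at $x$. Write $T_f^{-1}(0)=\{x : 0\in T_f(x)\}$ and $T_l^{-1}(0)=\{(w,z,x) : 0\in T_l(w,z,x)\}$. All norms and distances are Euclidean, and $\mathrm{dist}(y,\emptyset)=+\infty$. Then for every $r>0$ there exist constants $\kappa_f(r)>0$ and $\kappa_l(r)>0$ such that: 1. for every $x\in\mathbb{R}^n$ with $\mathrm{dist}(x,T_f^{-1}(0))\le r$, $$\mathrm{dist}(x,T_f^{-1}(0))\le\kappa_f(r)\,\mathrm{dist}(0,T_f(x));$$ 2. for every $(\bar w,\bar z,\bar x)\in T_l^{-1}(0)$ and every $(w,z,x)\in\mathbb{R}^{3n}$ with $\|(w,z,x)-(\bar w,\bar z,\bar x)\|\le r$, $$\mathrm{dist}\big((w,z,x),T_l^{-1}(0)\big)\le\kappa_l(r)\,\mathrm{dist}\big(0,T_l(w,z,x)\big).$$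 -/

import Mathlib

open scoped ENNReal InnerProductSpace

noncomputable section

namespace SVMDual

/-! ### Convex analysis with values in the extended reals -/

section Convex

variable {X Y : Type*} [NormedAddCommGroup X] [InnerProductSpace ℝ X]
  [NormedAddCommGroup Y] [InnerProductSpace ℝ Y]

open scoped Classical in
/-- Indicator function of a set `C`, equal to `0` on `C` and `+∞` elsewhere. -/
def indicatorFun (C : Set X) (x : X) : EReal := if x ∈ C then 0 else ⊤

/-- Conjugate function `p*(x) = sup_y (⟪x, y⟫ - p y)`. -/
def conjugate (p : X → EReal) (x : X) : EReal :=
  ⨆ y : X, (((⟪x, y⟫_ℝ : ℝ) : EReal) - p y)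

/-- Subdifferential of a convex function. -/
def subdiff (p : X → EReal) (x : X) : Set X :=
  {v | ∀ x' : X, p x + ((⟪v, x' - x⟫_ℝ : ℝ) : EReal) ≤ p x'}

/-- Superdifferential of a concave function. -/
def superdiff (q : Y → EReal) (y : Y) : Set Y :=
  {v | ∀ y' : Y, q y' ≤ q y + ((⟪v, y' - y⟫_ℝ : ℝ) : EReal)}

/-- Subdifferential of a convex-concave function `L` in the sense of Rockafellar: subgradients
in the convex variable paired with supergradients in the concave variable. -/
def saddleSubdiff (L : X → Y → EReal) (x : X) (y : Y) : Set (X × Y) :=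
  {v | v.1 ∈ subdiff (fun x' => L x' y) x ∧ v.2 ∈ superdiff (fun y' => L x y') y}

end Convex

/-- Inverse of a set-valued mapping. -/
def setInv {X Y : Type*} (F : X → Set Y) (y : Y) : Set X := {x | y ∈ F x}

/-! ### The quadratic program and its two operators -/

/-- `ℝⁿ` with the Euclidean norm. -/
abbrev Vec (n : ℕ) := EuclideanSpace ℝ (Fin n)

/-- `ℝⁿ × ℝⁿ` with the Euclidean norm. -/
abbrev Vec2 (n : ℕ) := WithLp 2 (Vec n × Vec n)

/-- `ℝⁿ × ℝⁿ × ℝⁿ`, grouped as `((w, z), x)`, with the Euclidean norm of `ℝ³ⁿ`. -/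
abbrev Vec3 (n : ℕ) := WithLp 2 (Vec2 n × Vec n)

variable {n : ℕ}

/-- The triple `(w, z, x)` as a point of `ℝ³ⁿ`. -/
def triple (w z x : Vec n) : Vec3 n := WithLp.toLp 2 (WithLp.toLp 2 (w, z), x)

/-- The hyperplane `{x | aᵀ x = d}`. -/
def hyperplane (a : Vec n) (d : ℝ) : Set (Vec n) := {x | ⟪a, x⟫_ℝ = d}

/-- The box `{x | lo ≤ x ≤ hi}`. -/
def box (lo hi : Vec n) : Set (Vec n) := {x | ∀ i, lo i ≤ x i ∧ x i ≤ hi i}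

/-- The matrix-vector product on Euclidean space. -/
def mulV (Q : Matrix (Fin n) (Fin n) ℝ) : Vec n →ₗ[ℝ] Vec n := Matrix.toEuclideanLin Q

/-- `f(x) = ½⟪x, Qx⟫ + ⟪c, x⟫ + δ_C(x)`. -/
def objective (Q : Matrix (Fin n) (Fin n) ℝ) (c : Vec n) (C : Set (Vec n)) (x : Vec n) : EReal :=
  ((1 / 2 * ⟪x, mulV Q x⟫_ℝ + ⟪c, x⟫_ℝ : ℝ) : EReal) + indicatorFun C x

open scoped Classical in
/-- The Lagrangian of the restricted dual problem: for `w` in the range of `Q` it is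
`½⟪w, Qw⟫ + δ_C*(z) - ⟪x, Qw + z + c⟫`, and it is `+∞` otherwise. -/
def lagrangian (Q : Matrix (Fin n) (Fin n) ℝ) (c : Vec n) (C : Set (Vec n))
    (w z x : Vec n) : EReal :=
  if w ∈ LinearMap.range (mulV Q) then
    ((1 / 2 * ⟪w, mulV Q w⟫_ℝ : ℝ) : EReal) + conjugate (indicatorFun C) z
      - ((⟪x, mulV Q w + z + c⟫_ℝ : ℝ) : EReal)
  else ⊤

/-- `T_f(x) = ∂f(x)`. -/
def Tf (Q : Matrix (Fin n) (Fin n) ℝ) (c : Vec n) (C : Set (Vec n)) (x : Vec n) : Set (Vec n) :=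
  subdiff (objective Q c C) x

/-- `T_l(w, z, x) = {(u_w, u_z, u_x) | (u_w, u_z, -u_x) ∈ ∂l(w, z, x)}`, where `l` is convex in
`(w, z)` and concave in `x`. -/
def Tl (Q : Matrix (Fin n) (Fin n) ℝ) (c : Vec n) (C : Set (Vec n)) (p : Vec3 n) :
    Set (Vec3 n) :=
  {v | (v.fst, -v.snd) ∈
    saddleSubdiff (fun (q : Vec2 n) (x : Vec n) => lagrangian Q c C q.fst q.snd x) p.fst p.snd}

end SVMDual

end

/-!
Both error bounds say that a set-valued map with piecewise polyhedral graph is upper Lipschitz at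
`0`. In the sense of Robinson: if the graph is a finite union of polyhedral sets, there are `K` and
`ε > 0` such that `v ∈ T x` and `‖v‖ ≤ ε` imply `dist (x, T⁻¹ 0) ≤ K * ‖v‖`. Points whose smallest
residual exceeds `ε` are within `r` of `T⁻¹ 0` by assumption, so `max K (r / ε)` is a valid constant
for all points considered (`exists_bound_of_local_bound`).

The polyhedral statement (`IsPolyhedral.exists_fiber_bound`) rests on Fourier–Motzkin elimination.
Eliminating one variable from a system `A p ≤ b` gives a system whose right-hand side is a linear
image of `b`, and the eliminated variable is recovered from an interval whose end points are
Lipschitz in the data. By induction on the number of variables, the solvable right-hand sides form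
a closed set (`isClosed_setOf_exists_sum_smul_le`) and the solution set is Lipschitz in `b` while it
is nonempty (`exists_lipschitz_sum_smul_le`); the latter is Hoffman's bound.

It remains to see that the graphs of `Tf` and `Tl` are projections of finite unions of polyhedral
sets. A vector `s` is normal to `C` at `x` exactly if, for some real multiplier `μ`, each coordinate
of `s - μ a` is normal to the interval `[lo i, hi i]` at `x i` (`mem_normalCone_iff`); the existence
of `μ` is again an elimination of one variable. Hence the graph of the normal cone is a finite union
over patterns of active bounds. Further, `v ∈ Tf x` if and only if `v - Q x - c` is normal to `C` at
`x` (`mem_Tf_iff`), and `(u_w, u_z, u_x) ∈ Tl (w, z, x)` if and only if `w` lies in the range of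
`Q`, `Q (Q w - Q x - u_w) = 0`, `z` is normal to `C` at `u_z + x`, and `u_x = Q w + z + c`
(`mem_Tl_iff`). If `C` is empty, nonempty values of the operators are the whole space and the
bounds are trivial.
-/

open scoped ENNReal InnerProductSpace

namespace SVMDual

/-! ### Elimination of one variable -/

section Elimination

variable {ι : Type}

/-- Indices of the inequalities that remain when `t` is eliminated from the system
`t * α i ≤ β i`: the inequalities without `t`, and the pairs of an upper and a lower bound. -/
abbrev ElimIdx (α : ι → ℝ) : Type := {i // α i = 0} ⊕ ({i // 0 < α i} × {j // α j < 0})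

/-- The linear map that sends the right-hand side `β` of the system `t * α i ≤ β i` to the
quantities whose nonnegativity is equivalent to solvability in `t`. -/
def elimMap (α : ι → ℝ) : (ι → ℝ) →ₗ[ℝ] (ElimIdx α → ℝ) where
  toFun β := Sum.elim (fun i => β i) (fun ij => -α ij.2 * β ij.1 + α ij.1 * β ij.2)
  map_add' β γ := by
    ext (i | ij)
    · simp
    · simp; ring
  map_smul' s β := by
    ext (i | ij)
    · simp
    · simp; ring

lemma elimMap_nonneg {α β : ι → ℝ} {t : ℝ} (h : ∀ i, t * α i ≤ β i) : 0 ≤ elimMap α β := by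
  rintro (⟨i, hi⟩ | ⟨⟨i, hi⟩, ⟨j, hj⟩⟩)
  · simpa [elimMap, hi] using h i
  · have h1 := mul_le_mul_of_nonneg_left (h i) (neg_nonneg.2 hj.le)
    have h2 := mul_le_mul_of_nonneg_left (h j) hi.le
    simp only [elimMap, LinearMap.coe_mk, AddHom.coe_mk, Sum.elim_inr, Pi.zero_apply]
    nlinarith

variable [Fintype ι]

/-- The solution set in `t` depends on the right-hand side in a Lipschitz way: the
solutions form an interval whose end points are quotients `β i / α i`. -/
lemma exists_lipschitz_of_elimMap_nonneg (α : ι → ℝ) :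
    ∃ K : ℝ, 0 ≤ K ∧ ∀ (β β' : ι → ℝ) (t : ℝ), (∀ i, t * α i ≤ β i) → 0 ≤ elimMap α β' →
      ∃ t', (∀ i, t' * α i ≤ β' i) ∧ |t - t'| ≤ K * ‖β - β'‖ := by
  classical
  refine ⟨∑ i, |α i|⁻¹, Finset.sum_nonneg fun i _ => by positivity, fun β β' t ht hβ' => ?_⟩
  set K := ∑ i, |α i|⁻¹
  set δ := ‖β - β'‖
  have hδ : 0 ≤ δ := norm_nonneg _
  have hK : ∀ i, |α i|⁻¹ * δ ≤ K * δ := fun i =>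
    mul_le_mul_of_nonneg_right
      (Finset.single_le_sum (f := fun i => |α i|⁻¹) (fun i _ => by positivity)
        (Finset.mem_univ i)) hδ
  have hK0 : 0 ≤ K * δ := mul_nonneg (Finset.sum_nonneg fun i _ => by positivity) hδ
  have hβ : ∀ i, t * α i - δ ≤ β' i := fun i => by
    have h1 : |β i - β' i| ≤ δ := by simpa using norm_le_pi_norm (β - β') i
    linarith [ht i, (abs_le.1 h1).2]
  -- `t'` is the largest of `t - K * δ` and of the lower bounds of the new system.
  set S : Finset ℝ := insert (t - K * δ) ((Finset.univ.filter fun j => α j < 0).image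
    fun j => β' j / α j) with hS
  have hSne : S.Nonempty := Finset.insert_nonempty _ _
  refine ⟨S.max' hSne, fun i => ?_, ?_⟩
  · rcases lt_trichotomy (α i) 0 with hi | hi | hi
    · have : β' i / α i ≤ S.max' hSne := S.le_max' _ (by
        rw [hS]
        exact Finset.mem_insert_of_mem (Finset.mem_image_of_mem _ (by simpa using hi)))
      rwa [div_le_iff_of_neg hi] at this
    · have := hβ' (Sum.inl ⟨i, hi⟩)
      simpa [elimMap, hi] using this
    · rw [← le_div_iff₀ hi]
      refine S.max'_le hSne _ fun y hy => ?_
      rw [hS, Finset.mem_insert, Finset.mem_image] at hy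
      rcases hy with rfl | ⟨j, hj, rfl⟩
      · rw [le_div_iff₀ hi]
        have h1 := hK i
        rw [abs_of_pos hi, inv_mul_le_iff₀ hi] at h1
        nlinarith [hβ i]
      · have hj' : α j < 0 := by simpa using hj
        have := hβ' (Sum.inr (⟨i, hi⟩, ⟨j, hj'⟩))
        simp only [elimMap, LinearMap.coe_mk, AddHom.coe_mk, Sum.elim_inr, Pi.zero_apply] at this
        rw [le_div_iff₀ hi, div_mul_eq_mul_div, div_le_iff_of_neg hj']
        linarith
  · rw [abs_sub_comm, abs_le]
    constructor
    · have : t - K * δ ≤ S.max' hSne := S.le_max' _ (Finset.mem_insert_self _ _)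
      linarith
    · rw [sub_le_iff_le_add]
      refine S.max'_le hSne _ fun y hy => ?_
      rw [hS, Finset.mem_insert, Finset.mem_image] at hy
      rcases hy with rfl | ⟨j, hj, rfl⟩
      · linarith
      · have hj' : α j < 0 := by simpa using hj
        have h1 := hK j
        rw [abs_of_neg hj', inv_mul_le_iff₀ (by linarith)] at h1
        rw [div_le_iff_of_neg hj']
        nlinarith [hβ j]

lemma exists_mul_le_iff (α β : ι → ℝ) : (∃ t : ℝ, ∀ i, t * α i ≤ β i) ↔ 0 ≤ elimMap α β := by
  refine ⟨fun ⟨t, ht⟩ => elimMap_nonneg ht, fun h => ?_⟩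
  obtain ⟨K, -, hK⟩ := exists_lipschitz_of_elimMap_nonneg α
  obtain ⟨t, ht, -⟩ := hK 0 β 0 (by simp) h
  exact ⟨t, ht⟩

end Elimination

/-! ### Systems of linear inequalities with varying right-hand side -/

section Systems

lemma exists_cons_system_iff {ι : Type} [Fintype ι] {k : ℕ} (A : Fin (k + 1) → ι → ℝ)
    (b : ι → ℝ) (p : Fin k → ℝ) :
    (∃ t : ℝ, ∑ j, (Fin.cons t p : Fin (k + 1) → ℝ) j • A j ≤ b) ↔
      ∑ j, p j • elimMap (A 0) (A j.succ) ≤ elimMap (A 0) b := by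
  have h1 : ∑ j, p j • elimMap (A 0) (A j.succ) =
      elimMap (A 0) (∑ j, p j • A j.succ) := by simp
  rw [h1, ← sub_nonneg, ← map_sub, ← exists_mul_le_iff]
  refine exists_congr fun t => ?_
  rw [Fin.sum_univ_succ, Pi.le_def]
  simp [le_sub_iff_add_le]

/-- The right-hand sides for which a system of linear inequalities is solvable form a closed
set. -/
lemma isClosed_setOf_exists_sum_smul_le (k : ℕ) : ∀ {ι : Type} [Fintype ι] (A : Fin k → ι → ℝ),
    IsClosed {b : ι → ℝ | ∃ p : Fin k → ℝ, ∑ j, p j • A j ≤ b} := by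
  induction k with
  | zero =>
    intro ι _ A
    convert isClosed_Ici (a := (0 : ι → ℝ)) using 1
    ext b
    simp
  | succ k ih =>
    intro ι _ A
    have h := (ih (fun j => elimMap (A 0) (A j.succ))).preimage
      (elimMap (A 0)).continuous_of_finiteDimensional
    convert h using 1
    ext b
    simp only [Set.mem_ofPred_eq, Set.mem_preimage, ← exists_cons_system_iff]
    rw [Fin.exists_fin_succ_pi, exists_comm]

/-- The solution set of a system of linear inequalities depends on the right-hand side in a
Lipschitz way, as long as it is nonempty. -/
lemma exists_lipschitz_sum_smul_le (k : ℕ) : ∀ {ι : Type} [Fintype ι] (A : Fin k → ι → ℝ),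
    ∃ K : ℝ, 0 ≤ K ∧ ∀ (b b' : ι → ℝ) (p p₀ : Fin k → ℝ), ∑ j, p j • A j ≤ b →
      ∑ j, p₀ j • A j ≤ b' → ∃ p' : Fin k → ℝ, ∑ j, p' j • A j ≤ b' ∧
        ‖p - p'‖ ≤ K * ‖b - b'‖ := by
  induction k with
  | zero =>
    intro ι _ A
    refine ⟨0, le_rfl, fun b b' p p₀ _ h => ⟨p, by simpa using h, ?_⟩⟩
    simp
  | succ k ih =>
    intro ι _ A
    obtain ⟨K₁, hK₁, h₁⟩ := ih (fun j => elimMap (A 0) (A j.succ))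
    obtain ⟨K₂, hK₂, h₂⟩ := exists_lipschitz_of_elimMap_nonneg (A 0)
    set M := (elimMap (A 0)).toContinuousLinearMap
    set N := (Fintype.linearCombination ℝ (fun j : Fin k => A j.succ)).toContinuousLinearMap
    have hN : ∀ p, N p = ∑ j, p j • A j.succ := fun p => rfl
    refine ⟨max (K₁ * ‖M‖) (K₂ * (1 + ‖N‖ * (K₁ * ‖M‖))), by positivity,
      fun b b' p p₀ hp hp₀ => ?_⟩
    set t := p 0
    set q : Fin k → ℝ := fun j => p j.succ
    have hpc : (Fin.cons t q : Fin (k + 1) → ℝ) = p := Fin.cons_self_tail p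
    have hq := (exists_cons_system_iff A b q).1 ⟨t, by rwa [hpc]⟩
    have hq₀ := (exists_cons_system_iff A b' (Fin.tail p₀)).1
      ⟨p₀ 0, by rwa [Fin.cons_self_tail]⟩
    obtain ⟨q', hq', hqq'⟩ := h₁ _ _ q _ hq hq₀
    have hM : ‖elimMap (A 0) b - elimMap (A 0) b'‖ ≤ ‖M‖ * ‖b - b'‖ := by
      rw [← map_sub]; exact M.le_opNorm _
    have hqq : ‖q - q'‖ ≤ K₁ * ‖M‖ * ‖b - b'‖ := by
      rw [mul_assoc]; exact hqq'.trans (mul_le_mul_of_nonneg_left hM hK₁)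
    obtain ⟨t', ht', htt'⟩ := h₂ (b - N q) (b' - N q') t
      (fun i => by
        have := hp i
        rw [← hpc, Fin.sum_univ_succ] at this
        simp only [Fin.cons_zero, Fin.cons_succ, Pi.add_apply, Pi.smul_apply,
          smul_eq_mul] at this
        rw [Pi.sub_apply, hN]
        linarith)
      (by
        rw [map_sub, sub_nonneg, hN]
        simpa using hq')
    refine ⟨Fin.cons t' q', fun i => ?_, ?_⟩
    · have := ht' i
      rw [Pi.sub_apply, hN] at this
      rw [Fin.sum_univ_succ]
      simp only [Fin.cons_zero, Fin.cons_succ, Pi.add_apply, Pi.smul_apply, smul_eq_mul]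
      linarith
    · have hd : ‖(b - N q) - (b' - N q')‖ ≤ (1 + ‖N‖ * (K₁ * ‖M‖)) * ‖b - b'‖ := by
        have e : (b - N q) - (b' - N q') = (b - b') - N (q - q') := by
          rw [map_sub]; abel
        rw [e]
        refine (norm_sub_le _ _).trans ?_
        have := (N.le_opNorm (q - q')).trans
          (mul_le_mul_of_nonneg_left hqq (norm_nonneg N))
        linarith
      have hm1 := le_max_left (K₁ * ‖M‖) (K₂ * (1 + ‖N‖ * (K₁ * ‖M‖)))
      have hm2 := le_max_right (K₁ * ‖M‖) (K₂ * (1 + ‖N‖ * (K₁ * ‖M‖)))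
      have hb := norm_nonneg (b - b')
      refine (pi_norm_le_iff_of_nonneg (by positivity)).2 fun j => ?_
      refine Fin.cases ?_ (fun j => ?_) j
      · simp only [Pi.sub_apply, Fin.cons_zero, Real.norm_eq_abs]
        refine htt'.trans ((mul_le_mul_of_nonneg_left hd hK₂).trans ?_)
        rw [← mul_assoc]
        exact mul_le_mul_of_nonneg_right hm2 hb
      · simp only [Pi.sub_apply, Fin.cons_succ]
        exact ((norm_le_pi_norm (q - q') j).trans hqq).trans
          (mul_le_mul_of_nonneg_right hm1 hb)

end Systems

/-! ### Polyhedral sets -/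

section Polyhedral

variable {E F : Type*} [AddCommGroup E] [Module ℝ E] [AddCommGroup F] [Module ℝ F]

/-- A set is polyhedral if it is the solution set of finitely many linear inequalities, written
here as one inequality `A p ≤ b` between vectors. -/
def IsPolyhedral (S : Set E) : Prop :=
  ∃ (ι : Type) (_ : Fintype ι) (A : E →ₗ[ℝ] (ι → ℝ)) (b : ι → ℝ), S = {p | A p ≤ b}

lemma isPolyhedral_le (f : E →ₗ[ℝ] ℝ) (c : ℝ) : IsPolyhedral {p | f p ≤ c} :=
  ⟨Unit, inferInstance, LinearMap.pi fun _ => f, fun _ => c, by ext p; simp [Pi.le_def]⟩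

lemma isPolyhedral_ge (f : E →ₗ[ℝ] ℝ) (c : ℝ) : IsPolyhedral {p | c ≤ f p} := by
  convert isPolyhedral_le (-f) (-c) using 3 with p
  simp

lemma IsPolyhedral.forall {κ : Type} [Fintype κ] {P : κ → E → Prop}
    (h : ∀ i, IsPolyhedral {p | P i p}) : IsPolyhedral {p | ∀ i, P i p} := by
  choose ι hι A b hA using h
  refine ⟨Σ i, ι i, inferInstance, LinearMap.pi fun s => LinearMap.proj s.2 ∘ₗ A s.1,
    fun s => b s.1 s.2, ?_⟩
  ext p
  have : ∀ i, P i p ↔ A i p ≤ b i := fun i => Set.ext_iff.1 (hA i) p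
  simp [this, Pi.le_def, Sigma.forall]

lemma IsPolyhedral.and {P R : E → Prop} (hP : IsPolyhedral {p | P p})
    (hR : IsPolyhedral {p | R p}) : IsPolyhedral {p | P p ∧ R p} := by
  have := IsPolyhedral.forall (κ := Bool) (P := fun i p => bif i then P p else R p)
    (by rintro (_ | _) <;> assumption)
  simpa [Bool.forall_bool, and_comm] using this

lemma isPolyhedral_eq (f : E →ₗ[ℝ] ℝ) (c : ℝ) : IsPolyhedral {p | f p = c} := by
  simpa only [le_antisymm_iff] using (isPolyhedral_le f c).and (isPolyhedral_ge f c)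

lemma isPolyhedral_eq_vec {n : ℕ} (f : E →ₗ[ℝ] Vec n) (c : Vec n) :
    IsPolyhedral {p | f p = c} := by
  have := IsPolyhedral.forall fun i : Fin n =>
    isPolyhedral_eq ((EuclideanSpace.proj i).toLinearMap ∘ₗ f) (c i)
  convert this using 3 with p
  exact PiLp.ext_iff

lemma IsPolyhedral.preimage {S : Set F} (hS : IsPolyhedral S) (L : E →ₗ[ℝ] F) (c : F) :
    IsPolyhedral {p | L p + c ∈ S} := by
  obtain ⟨ι, hι, A, b, rfl⟩ := hS
  refine ⟨ι, hι, A ∘ₗ L, b - A c, ?_⟩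
  ext p
  simp [le_sub_iff_add_le]

end Polyhedral

section Stability

variable {E V : Type*} [NormedAddCommGroup E] [NormedSpace ℝ E] [FiniteDimensional ℝ E]
  [NormedAddCommGroup V] [NormedSpace ℝ V] [FiniteDimensional ℝ V]

/-- Upper Lipschitz behaviour of a set-valued map with polyhedral graph: the fibre over a small
`v` is nonempty only if the fibre over `0` is, and it lies within a multiple of `‖v‖` of it. -/
theorem IsPolyhedral.exists_fiber_bound {S : Set (E × V)} (hS : IsPolyhedral S) :
    ∃ K : ℝ, ∃ ε > 0, ∀ p v, (p, v) ∈ S → ‖v‖ ≤ ε → ∃ p', (p', 0) ∈ S ∧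
      ‖p - p'‖ ≤ K * ‖v‖ := by
  obtain ⟨ι, _, A, b, rfl⟩ := hS
  set e := (Module.finBasis ℝ E).equivFun
  set B := (A ∘ₗ LinearMap.inr ℝ E V).toContinuousLinearMap
  set a : Fin (Module.finrank ℝ E) → ι → ℝ := fun j => A (Module.finBasis ℝ E j, 0)
  have hA : ∀ p v, A (p, v) = ∑ j, e p j • a j + B v := fun p v => by
    have h1 : (p, v) = LinearMap.inl ℝ E V p + LinearMap.inr ℝ E V v := by simp
    rw [h1, map_add]
    congr 1
    have h2 := congrArg (A ∘ₗ LinearMap.inl ℝ E V) ((Module.finBasis ℝ E).sum_equivFun p)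
    rw [map_sum] at h2
    simpa [a, e] using h2.symm
  obtain ⟨K, hK, hlip⟩ := exists_lipschitz_sum_smul_le _ a
  have hcl := isClosed_setOf_exists_sum_smul_le _ a
  set Φ := (e.symm : (Fin (Module.finrank ℝ E) → ℝ) →ₗ[ℝ] E).toContinuousLinearMap
  have hBcont : Continuous fun v => b - B v := by fun_prop
  have key : ∀ p v, (p, v) ∈ {q : E × V | A q ≤ b} →
      ∀ p₀ : Fin (Module.finrank ℝ E) → ℝ, ∑ j, p₀ j • a j ≤ b →
      ∃ p', (p', 0) ∈ {q : E × V | A q ≤ b} ∧ ‖p - p'‖ ≤ ‖Φ‖ * (K * ‖B‖) * ‖v‖ := by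
    intro p v hp p₀ hp₀
    rw [Set.mem_ofPred_eq, hA, ← le_sub_iff_add_le] at hp
    obtain ⟨q, hq, hpq⟩ := hlip _ _ _ _ hp hp₀
    refine ⟨e.symm q, ?_, ?_⟩
    · rw [Set.mem_ofPred_eq, hA]
      simpa using hq
    · have h1 : p - e.symm q = Φ (e p - q) := by
        simp [Φ]
      have h2 : ‖b - B v - b‖ ≤ ‖B‖ * ‖v‖ := by
        simpa using B.le_opNorm v
      rw [h1, mul_assoc, mul_assoc]
      exact (Φ.le_opNorm _).trans (mul_le_mul_of_nonneg_left
        (hpq.trans (mul_le_mul_of_nonneg_left h2 hK)) (norm_nonneg _))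
  by_cases hb : ∃ p₀ : Fin (Module.finrank ℝ E) → ℝ, ∑ j, p₀ j • a j ≤ b
  · obtain ⟨p₀, hp₀⟩ := hb
    exact ⟨_, 1, one_pos, fun p v hp _ => key p v hp p₀ hp₀⟩
  · -- An infeasible system stays infeasible under small perturbations.
    have hop := (hcl.preimage hBcont).isOpen_compl
    have h0 : (0 : V) ∈ ((fun v => b - B v) ⁻¹' {b | ∃ p : Fin (Module.finrank ℝ E) → ℝ,
        ∑ j, p j • a j ≤ b})ᶜ := by simpa using hb
    obtain ⟨ε, hε, hball⟩ := Metric.nhds_basis_closedBall.mem_iff.1 (hop.mem_nhds h0)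
    refine ⟨0, ε, hε, fun p v hp hv => absurd ?_ (hball (by simpa using hv))⟩
    rw [Set.mem_ofPred_eq, hA, ← le_sub_iff_add_le] at hp
    exact ⟨e p, hp⟩

/-- The same bound for a finite union of polyhedral graphs. -/
theorem exists_fiber_bound_of_forall_isPolyhedral {κ : Type} [Fintype κ]
    {S : κ → Set (E × V)} (hS : ∀ i, IsPolyhedral (S i)) :
    ∃ K : ℝ, ∃ ε > 0, ∀ i p v, (p, v) ∈ S i → ‖v‖ ≤ ε → ∃ p', (p', 0) ∈ S i ∧
      ‖p - p'‖ ≤ K * ‖v‖ := by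
  choose K ε hε h using fun i => (hS i).exists_fiber_bound
  obtain ⟨K', hK'⟩ := (Set.finite_range K).bddAbove
  have hev : ∀ᶠ δ in nhdsWithin (0 : ℝ) (Set.Ioi 0), ∀ i, δ ≤ ε i :=
    Filter.eventually_all.2 fun i => by
      filter_upwards [Ioc_mem_nhdsGT (hε i)] with δ hδ using hδ.2
  obtain ⟨δ, hδ, hδ0⟩ := (hev.and self_mem_nhdsWithin).exists
  refine ⟨K', δ, hδ0, fun i p v hp hv => ?_⟩
  obtain ⟨p', hp', hpp'⟩ := h i p v hp (hv.trans (hδ i))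
  exact ⟨p', hp', hpp'.trans
    (mul_le_mul_of_nonneg_right (hK' (Set.mem_range_self i)) (norm_nonneg _))⟩

end Stability

/-! ### From local to bounded metric subregularity -/

lemma exists_bound_of_local_bound {X V : Type*} [NormedAddCommGroup X] [NormedAddCommGroup V]
    {T : X → Set V} {K ε : ℝ} (hε : 0 < ε)
    (hT : ∀ x v, v ∈ T x → ‖v‖ ≤ ε → ∃ x' ∈ setInv T 0, ‖x - x'‖ ≤ K * ‖v‖) {r : ℝ}
    (hr : 0 < r) :
    ∃ K' : ℝ, 0 < K' ∧ ∀ x, Metric.infEDist x (setInv T 0) ≤ ENNReal.ofReal r →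
      Metric.infEDist x (setInv T 0) ≤ ENNReal.ofReal K' * Metric.infEDist 0 (T x) := by
  have hpos : 0 < max K (r / ε) := lt_max_of_lt_right (by positivity)
  refine ⟨max K (r / ε), hpos, fun x hx => ?_⟩
  have hne := (ENNReal.ofReal_pos.2 hpos).ne'
  rw [← ENNReal.div_le_iff' hne ENNReal.ofReal_ne_top, Metric.le_infEDist]
  intro v hv
  rw [ENNReal.div_le_iff' hne ENNReal.ofReal_ne_top, edist_comm, edist_zero_right, ← ofReal_norm,
    ← ENNReal.ofReal_mul hpos.le]
  rcases le_total ‖v‖ ε with h | h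
  · obtain ⟨x', hx', hxx'⟩ := hT x v hv h
    refine (Metric.infEDist_le_edist_of_mem hx').trans ?_
    rw [edist_dist, dist_eq_norm]
    exact ENNReal.ofReal_le_ofReal (hxx'.trans
      (mul_le_mul_of_nonneg_right (le_max_left _ _) (norm_nonneg _)))
  · refine hx.trans (ENNReal.ofReal_le_ofReal ?_)
    calc r = r / ε * ε := by field_simp
      _ ≤ _ := mul_le_mul (le_max_right _ _) h hε.le hpos.le

/-! ### The normal cone of the feasible set -/

section NormalCone

variable {n : ℕ} {lo hi a : Vec n} {d : ℝ} {x s : Vec n}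

/-- The normal cone of `C` at `x`, empty for `x ∉ C`. -/
def normalCone (C : Set (Vec n)) (x : Vec n) : Set (Vec n) :=
  {s | x ∈ C ∧ ∀ y ∈ C, ⟪s, y - x⟫_ℝ ≤ 0}

/-- A normal vector makes a nonpositive product with every tangent direction; here the tangent
cone is described by the active bounds. -/
lemma inner_nonpos_of_mem_normalCone (hs : s ∈ normalCone (box lo hi ∩ hyperplane a d) x)
    {h : Vec n} (hhi : ∀ i, x i = hi i → h i ≤ 0) (hlo : ∀ i, x i = lo i → 0 ≤ h i)
    (ha : ⟪a, h⟫_ℝ = 0) : ⟪s, h⟫_ℝ ≤ 0 := by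
  obtain ⟨⟨hbox, hhyp⟩, hs⟩ := hs
  have hlim : ∀ i, Filter.Tendsto (fun t : ℝ => x i + t * h i) (nhdsWithin 0 (Set.Ioi 0))
      (nhds (x i)) := fun i => by
    have : Continuous fun t : ℝ => x i + t * h i := by fun_prop
    simpa using (this.tendsto 0).mono_left nhdsWithin_le_nhds
  have hev : ∀ᶠ t : ℝ in nhdsWithin 0 (Set.Ioi 0),
      ∀ i, lo i ≤ x i + t * h i ∧ x i + t * h i ≤ hi i := by
    refine Filter.eventually_all.2 fun i => Filter.Eventually.and ?_ ?_
    · rcases (hbox i).1.eq_or_lt with h' | h'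
      · filter_upwards [self_mem_nhdsWithin] with t ht
        have := mul_nonneg (le_of_lt ht) (hlo i h'.symm)
        linarith
      · exact ((hlim i).eventually (lt_mem_nhds h')).mono fun t ht => ht.le
    · rcases (hbox i).2.eq_or_lt with h' | h'
      · filter_upwards [self_mem_nhdsWithin] with t ht
        have := mul_nonpos_of_nonneg_of_nonpos (le_of_lt ht) (hhi i h')
        linarith
      · exact ((hlim i).eventually (gt_mem_nhds h')).mono fun t ht => ht.le
  obtain ⟨t, ht, ht0⟩ := (hev.and self_mem_nhdsWithin).exists
  have ht0 : 0 < t := ht0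
  have hmem : x + t • h ∈ box lo hi ∩ hyperplane a d := by
    refine ⟨fun i => by simpa using ht i, ?_⟩
    change ⟪a, x + t • h⟫_ℝ = d
    rw [inner_add_right, inner_smul_right, ha, mul_zero, add_zero]
    exact hhyp
  have := hs _ hmem
  rw [add_sub_cancel_left, inner_smul_right] at this
  exact nonpos_of_mul_nonpos_right this ht0

/-- Existence of a multiplier for the linear constraint. Eliminating the multiplier from its
defining inequalities leaves one inequality for each combination of at most two coordinate
directions that is tangent to the feasible set. -/
lemma exists_multiplier (hs : s ∈ normalCone (box lo hi ∩ hyperplane a d) x) :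
    ∃ μ : ℝ, ∀ i, (x i < hi i → s i ≤ μ * a i) ∧ (lo i < x i → μ * a i ≤ s i) := by
  classical
  -- `e` lists the coordinate directions along which the box is not left at once.
  let e : {i // x i < hi i} ⊕ {i // lo i < x i} → Vec n :=
    Sum.elim (fun i => EuclideanSpace.single i.1 1) (fun i => -EuclideanSpace.single i.1 1)
  have hehi : ∀ k i, x i = hi i → e k i ≤ 0 := by
    rintro (⟨j, hj⟩ | ⟨j, hj⟩) i h
    · have : i ≠ j := by rintro rfl; exact hj.ne h
      simp [e, this]
    · simp only [e, Sum.elim_inr, PiLp.neg_apply, PiLp.single_apply]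
      split_ifs <;> simp
  have helo : ∀ k i, x i = lo i → 0 ≤ e k i := by
    rintro (⟨j, hj⟩ | ⟨j, hj⟩) i h
    · simp only [e, Sum.elim_inl, PiLp.single_apply]
      split_ifs <;> simp
    · have : i ≠ j := by rintro rfl; exact hj.ne' h
      simp [e, this]
  obtain ⟨μ, hμ⟩ := (exists_mul_le_iff (fun k => -⟪a, e k⟫_ℝ) (fun k => -⟪s, e k⟫_ℝ)).2 (by
    rintro (⟨k, hk⟩ | ⟨⟨k, hk⟩, ⟨m, hm⟩⟩)
    · have := inner_nonpos_of_mem_normalCone hs (hehi k) (helo k) (by simpa using hk)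
      simpa [elimMap] using this
    · have := inner_nonpos_of_mem_normalCone hs
        (h := ⟪a, e m⟫_ℝ • e k + (-⟪a, e k⟫_ℝ) • e m)
        (fun i h => by
          simp only [PiLp.add_apply, PiLp.smul_apply, smul_eq_mul]
          nlinarith [hehi k i h, hehi m i h])
        (fun i h => by
          simp only [PiLp.add_apply, PiLp.smul_apply, smul_eq_mul]
          nlinarith [helo k i h, helo m i h])
        (by simp only [inner_add_right, inner_smul_right]; ring)
      simp only [inner_add_right, inner_smul_right] at this
      simp only [elimMap, LinearMap.coe_mk, AddHom.coe_mk, Sum.elim_inr, Pi.zero_apply]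
      linarith)
  refine ⟨μ, fun i => ⟨fun h => ?_, fun h => ?_⟩⟩
  · have := hμ (Sum.inl ⟨i, h⟩)
    simp only [e, Sum.elim_inl, EuclideanSpace.inner_single_right] at this
    simp at this
    linarith
  · have := hμ (Sum.inr ⟨i, h⟩)
    simp only [e, Sum.elim_inr, inner_neg_right, EuclideanSpace.inner_single_right] at this
    simp at this
    linarith

/-- Optimality conditions at coordinate `i` for a point `x`, a normal vector `s` and a multiplier
`μ`: either `s i = μ * a i`, or one of the two bounds is active and the sign is prescribed. -/
def coordPiece (lo hi a : Vec n) (i : Fin n) : SignType → Set (Vec n × Vec n × ℝ)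
  | .zero => {q | q.2.1 i - q.2.2 * a i = 0}
  | .neg => {q | q.1 i = lo i ∧ q.2.1 i - q.2.2 * a i ≤ 0}
  | .pos => {q | q.1 i = hi i ∧ 0 ≤ q.2.1 i - q.2.2 * a i}

/-- The piece of the graph of the normal cone, with multiplier, that belongs to the pattern `σ` of
active bounds: triples `(x, s, μ)` with `x` feasible. -/
def normalPiece (lo hi a : Vec n) (d : ℝ) (σ : Fin n → SignType) : Set (Vec n × Vec n × ℝ) :=
  {q | (∀ i, (lo i ≤ q.1 i ∧ q.1 i ≤ hi i) ∧ q ∈ coordPiece lo hi a i (σ i)) ∧ ⟪a, q.1⟫_ℝ = d}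

lemma mem_normalCone_iff : s ∈ normalCone (box lo hi ∩ hyperplane a d) x ↔
    ∃ σ μ, (x, s, μ) ∈ normalPiece lo hi a d σ := by
  constructor
  · intro hs
    obtain ⟨μ, hμ⟩ := exists_multiplier hs
    obtain ⟨⟨hbox, hhyp⟩, -⟩ := hs
    have : ∀ i, ∃ σ, (x, s, μ) ∈ coordPiece lo hi a i σ := by
      intro i
      by_cases h1 : x i < hi i
      · by_cases h2 : lo i < x i
        · exact ⟨.zero, sub_eq_zero.2 (le_antisymm ((hμ i).1 h1) ((hμ i).2 h2))⟩
        · exact ⟨.neg, le_antisymm (not_lt.1 h2) (hbox i).1, sub_nonpos.2 ((hμ i).1 h1)⟩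
      · by_cases h2 : lo i < x i
        · exact ⟨.pos, le_antisymm (hbox i).2 (not_lt.1 h1), sub_nonneg.2 ((hμ i).2 h2)⟩
        · have e1 := le_antisymm (not_lt.1 h2) (hbox i).1
          have e2 := le_antisymm (hbox i).2 (not_lt.1 h1)
          rcases le_total (s i - μ * a i) 0 with h | h
          · exact ⟨.neg, e1, h⟩
          · exact ⟨.pos, e2, h⟩
    choose σ hσ using this
    exact ⟨σ, μ, fun i => ⟨hbox i, hσ i⟩, hhyp⟩
  · rintro ⟨σ, μ, hq, hd⟩
    refine ⟨⟨fun i => (hq i).1, hd⟩, fun y hy => ?_⟩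
    have h1 : ⟪s, y - x⟫_ℝ = ⟪s - μ • a, y - x⟫_ℝ := by
      have h2 : ⟪a, y⟫_ℝ = d := hy.2
      have h3 : ⟪a, x⟫_ℝ = d := hd
      simp [inner_sub_left, inner_sub_right, inner_smul_left, h2, h3]
    rw [h1, PiLp.inner_apply]
    refine Finset.sum_nonpos fun i _ => ?_
    have hyi := hy.1 i
    have hqi := (hq i).2
    simp only [PiLp.sub_apply, PiLp.smul_apply, smul_eq_mul, RCLike.inner_apply, conj_trivial]
    cases hσ : σ i <;> rw [hσ] at hqi
    · have : s i - μ * a i = 0 := hqi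
      simp [this]
    · obtain ⟨h4, h5⟩ : x i = lo i ∧ s i - μ * a i ≤ 0 := hqi
      exact mul_nonpos_of_nonneg_of_nonpos (by linarith [hyi.1]) h5
    · obtain ⟨h4, h5⟩ : x i = hi i ∧ 0 ≤ s i - μ * a i := hqi
      exact mul_nonpos_of_nonpos_of_nonneg (by linarith [hyi.2]) h5

lemma isPolyhedral_normalPiece (lo hi a : Vec n) (d : ℝ) (σ : Fin n → SignType) :
    IsPolyhedral (normalPiece lo hi a d σ) := by
  let X (i : Fin n) : (Vec n × Vec n × ℝ) →ₗ[ℝ] ℝ :=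
    (EuclideanSpace.proj i).toLinearMap ∘ₗ LinearMap.fst ℝ _ _
  let R (i : Fin n) : (Vec n × Vec n × ℝ) →ₗ[ℝ] ℝ :=
    (EuclideanSpace.proj i).toLinearMap ∘ₗ LinearMap.fst ℝ _ _ ∘ₗ LinearMap.snd ℝ _ _ -
      (LinearMap.snd ℝ _ _ ∘ₗ LinearMap.snd ℝ _ _).smulRight (a i)
  have hcoord : ∀ i, IsPolyhedral (coordPiece lo hi a i (σ i)) := by
    intro i
    cases σ i
    · exact isPolyhedral_eq (R i) 0
    · exact (isPolyhedral_eq (X i) (lo i)).and (isPolyhedral_le (R i) 0)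
    · exact (isPolyhedral_eq (X i) (hi i)).and (isPolyhedral_ge (R i) 0)
  refine IsPolyhedral.and (IsPolyhedral.forall fun i =>
    ((isPolyhedral_ge (X i) (lo i)).and (isPolyhedral_le (X i) (hi i))).and (hcoord i)) ?_
  exact isPolyhedral_eq ((innerSL ℝ a).toLinearMap ∘ₗ LinearMap.fst ℝ (Vec n) (Vec n × ℝ)) d

end NormalCone

/-! ### The support function of the feasible set -/

section Support

variable {n : ℕ} {lo hi a : Vec n} {d : ℝ}

lemma isCompact_box_inter_hyperplane (lo hi a : Vec n) (d : ℝ) :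
    IsCompact (box lo hi ∩ hyperplane a d) := by
  have hbox : box lo hi = (EuclideanSpace.equiv (Fin n) ℝ).toHomeomorph ⁻¹'
      Set.Icc lo.ofLp hi.ofLp := by
    ext x
    simp [box, Set.mem_Icc, Pi.le_def, forall_and]
  refine IsCompact.inter_right ?_ (isClosed_eq (by fun_prop) continuous_const)
  rw [hbox, Homeomorph.isCompact_preimage]
  exact isCompact_Icc

lemma conjugate_indicatorFun_eq {C : Set (Vec n)} {z : Vec n} {m : ℝ}
    (hm : IsGreatest ((fun y => ⟪z, y⟫_ℝ) '' C) m) : conjugate (indicatorFun C) z = m := by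
  obtain ⟨⟨y, hy, rfl⟩, hub⟩ := hm
  refine le_antisymm (iSup_le fun y' => ?_) (le_iSup_of_le y (by simp [indicatorFun, hy]))
  by_cases hy' : y' ∈ C
  · simpa [indicatorFun, hy'] using hub (Set.mem_image_of_mem _ hy')
  · simp [indicatorFun, hy']

/-- On a nonempty compact set the support function is real-valued and the supremum is attained. -/
lemma exists_support {C : Set (Vec n)} (hC : IsCompact C) (hne : C.Nonempty) :
    ∃ S : Vec n → ℝ, ∀ z, conjugate (indicatorFun C) z = S z ∧
      IsGreatest ((fun y => ⟪z, y⟫_ℝ) '' C) (S z) := by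
  have : ∀ z : Vec n, ∃ m, IsGreatest ((fun y => ⟪z, y⟫_ℝ) '' C) m := fun z =>
    (hC.image (by fun_prop)).exists_isGreatest (hne.image _)
  choose S hS using this
  exact ⟨S, fun z => ⟨conjugate_indicatorFun_eq (hS z), hS z⟩⟩

/-- The subdifferential of the support function inverts the normal cone. -/
lemma support_subgradient_iff {S : Vec n → ℝ}
    (hS : ∀ z, IsGreatest ((fun y => ⟪z, y⟫_ℝ) '' (box lo hi ∩ hyperplane a d)) (S z))
    (y z : Vec n) : (∀ z', S z + ⟪y, z' - z⟫_ℝ ≤ S z') ↔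
      z ∈ normalCone (box lo hi ∩ hyperplane a d) y := by
  have hub : ∀ z, ∀ y ∈ box lo hi ∩ hyperplane a d, ⟪z, y⟫_ℝ ≤ S z := fun z y hy =>
    (hS z).2 (Set.mem_image_of_mem _ hy)
  have hS0 : S 0 = 0 := by
    obtain ⟨y, -, hy⟩ := (hS 0).1
    simpa using hy.symm
  constructor
  · intro h
    -- A bound for the product with `k` on the feasible set holds at `y` too: move `z` along `k`.
    have hdir : ∀ k : Vec n, ∀ m : ℝ, (∀ y' ∈ box lo hi ∩ hyperplane a d, ⟪k, y'⟫_ℝ ≤ m) →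
        ⟪k, y⟫_ℝ ≤ m := by
      intro k m hk
      obtain ⟨y', hy', he⟩ := (hS (z + k)).1
      have h1 := h (z + k)
      have h2 := hub z y' hy'
      have h3 := hk y' hy'
      simp only [inner_add_left] at he
      rw [add_sub_cancel_left, real_inner_comm] at h1
      linarith
    refine ⟨⟨fun i => ⟨?_, ?_⟩, le_antisymm ?_ ?_⟩, fun y' hy' => ?_⟩
    · have := hdir (-EuclideanSpace.single i 1) (-lo i) (fun y' hy' => by
        simpa [EuclideanSpace.inner_single_left] using (hy'.1 i).1)
      simpa [EuclideanSpace.inner_single_left] using this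
    · have := hdir (EuclideanSpace.single i 1) (hi i) (fun y' hy' => by
        simpa [EuclideanSpace.inner_single_left] using (hy'.1 i).2)
      simpa [EuclideanSpace.inner_single_left] using this
    · exact hdir a d fun y' hy' => le_of_eq hy'.2
    · have := hdir (-a) (-d) fun y' hy' => by
        rw [inner_neg_left, neg_le_neg_iff]; exact ge_of_eq hy'.2
      rwa [inner_neg_left, neg_le_neg_iff] at this
    · have h1 := h 0
      rw [hS0, zero_sub, inner_neg_right, real_inner_comm] at h1
      rw [inner_sub_right]
      linarith [hub z y' hy']
  · rintro ⟨hy, hz⟩ z'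
    obtain ⟨y', hy', he⟩ := (hS z).1
    have h1 := hz y' hy'
    have h2 := hub z' y hy
    simp only at he
    rw [inner_sub_right, he] at h1
    rw [inner_sub_right, real_inner_comm z' y, real_inner_comm z y]
    linarith

end Support

/-! ### The two operators in terms of the normal cone -/

section Operators

variable {n : ℕ} {Q : Matrix (Fin n) (Fin n) ℝ}

lemma inner_mulV_comm (hQ : Q.PosSemidef) (x y : Vec n) :
    ⟪mulV Q x, y⟫_ℝ = ⟪x, mulV Q y⟫_ℝ :=
  (Matrix.isSymmetric_toEuclideanLin_iff.2 hQ.isHermitian) x y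

lemma inner_mulV_nonneg (hQ : Q.PosSemidef) (x : Vec n) : 0 ≤ ⟪x, mulV Q x⟫_ℝ := by
  have := (Matrix.isPositive_toEuclideanLin_iff.2 hQ).re_inner_nonneg_right x
  simpa [mulV] using this

/-- Expansion of the quadratic form along a line. -/
lemma inner_mulV_add_smul (hQ : Q.PosSemidef) (x h : Vec n) (t : ℝ) :
    ⟪x + t • h, mulV Q (x + t • h)⟫_ℝ =
      ⟪x, mulV Q x⟫_ℝ + 2 * t * ⟪mulV Q x, h⟫_ℝ + t ^ 2 * ⟪h, mulV Q h⟫_ℝ := by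
  simp only [map_add, map_smul, inner_add_left, inner_add_right, inner_smul_left,
    inner_smul_right, conj_trivial, ← inner_mulV_comm hQ x h, real_inner_comm (mulV Q x) h]
  ring

lemma nonpos_of_forall_le_mul {α β : ℝ} (h : ∀ t : ℝ, 0 < t → t ≤ 1 → α ≤ t * β) : α ≤ 0 := by
  have hlim : Filter.Tendsto (fun t : ℝ => t * β) (nhdsWithin 0 (Set.Ioi 0)) (nhds 0) := by
    have : Continuous fun t : ℝ => t * β := by fun_prop
    simpa using (this.tendsto 0).mono_left nhdsWithin_le_nhds
  refine ge_of_tendsto hlim ?_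
  filter_upwards [Ioc_mem_nhdsGT one_pos] with t ht using h t ht.1 ht.2

lemma mem_Tf_iff (hQ : Q.PosSemidef) (c : Vec n) {C : Set (Vec n)} (hC : Convex ℝ C)
    (hne : C.Nonempty) (x v : Vec n) :
    v ∈ Tf Q c C x ↔ v - mulV Q x - c ∈ normalCone C x := by
  have hin : ∀ y ∈ C, objective Q c C y =
      ((1 / 2 * ⟪y, mulV Q y⟫_ℝ + ⟪c, y⟫_ℝ : ℝ) : EReal) := fun y hy => by
    simp [objective, indicatorFun, hy]
  have hout : ∀ y ∉ C, objective Q c C y = ⊤ := fun y hy => by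
    simp only [objective, indicatorFun, hy, if_false]
    exact EReal.coe_add_top _
  constructor
  · intro hv
    have hx : x ∈ C := by
      by_contra hx
      obtain ⟨y, hy⟩ := hne
      have := hv y
      rw [hin y hy, hout x hx, EReal.top_add_coe, top_le_iff] at this
      exact EReal.coe_ne_top _ this
    refine ⟨hx, fun y hy => ?_⟩
    refine nonpos_of_forall_le_mul (β := 1 / 2 * ⟪y - x, mulV Q (y - x)⟫_ℝ) fun t ht ht1 => ?_
    have hmem : x + t • (y - x) ∈ C := hC.add_smul_sub_mem hx hy ⟨ht.le, ht1⟩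
    have h1 := hv (x + t • (y - x))
    rw [hin _ hx, hin _ hmem, ← EReal.coe_add, EReal.coe_le_coe_iff,
      inner_mulV_add_smul hQ] at h1
    rw [add_sub_cancel_left, inner_add_right, inner_smul_right, inner_smul_right] at h1
    rw [inner_sub_left, inner_sub_left]
    refine le_of_mul_le_mul_left ?_ ht
    linarith
  · rintro ⟨hx, hs⟩ y
    by_cases hy : y ∈ C
    · rw [hin _ hx, hin _ hy, ← EReal.coe_add, EReal.coe_le_coe_iff]
      have h1 := inner_mulV_add_smul hQ x (y - x) 1
      have h2 := hs y hy
      have h3 := inner_mulV_nonneg hQ (y - x)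
      rw [one_smul, add_sub_cancel] at h1
      rw [inner_sub_left, inner_sub_left, inner_sub_right c] at h2
      linarith
    · rw [hout y hy]
      exact le_top

lemma mem_Tl_iff (hQ : Q.PosSemidef) (c : Vec n) {lo hi a : Vec n} {d : ℝ}
    (hne : (box lo hi ∩ hyperplane a d).Nonempty) (w z x uw uz ux : Vec n) :
    triple uw uz ux ∈ Tl Q c (box lo hi ∩ hyperplane a d) (triple w z x) ↔
      (∃ h, mulV Q h = w) ∧ mulV Q (mulV Q w - mulV Q x - uw) = 0 ∧
      z ∈ normalCone (box lo hi ∩ hyperplane a d) (uz + x) ∧ mulV Q w + z + c = ux := by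
  set C := box lo hi ∩ hyperplane a d
  obtain ⟨S, hS⟩ := exists_support (isCompact_box_inter_hyperplane lo hi a d) hne
  have hin : ∀ w z x : Vec n, (∃ h, mulV Q h = w) → lagrangian Q c C w z x =
      ((1 / 2 * ⟪w, mulV Q w⟫_ℝ + S z - ⟪x, mulV Q w + z + c⟫_ℝ : ℝ) : EReal) := by
    intro w z x hw
    rw [lagrangian, if_pos (LinearMap.mem_range.2 hw), (hS z).1]
    norm_cast
  have hout : ∀ w z x : Vec n, (¬ ∃ h, mulV Q h = w) → lagrangian Q c C w z x = ⊤ := by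
    intro w z x hw
    rw [lagrangian, if_neg (mt LinearMap.mem_range.1 hw)]
  have hmem : triple uw uz ux ∈ Tl Q c C (triple w z x) ↔
      (∀ w' z', lagrangian Q c C w z x + ((⟪uw, w' - w⟫_ℝ + ⟪uz, z' - z⟫_ℝ : ℝ) : EReal) ≤
        lagrangian Q c C w' z' x) ∧
      ∀ x', lagrangian Q c C w z x' ≤ lagrangian Q c C w z x + ((⟪-ux, x' - x⟫_ℝ : ℝ) : EReal) := by
    refine and_congr ⟨fun h w' z' => ?_, fun h q => ?_⟩ Iff.rfl
    · simpa [WithLp.prod_inner_apply, triple] using h (WithLp.toLp 2 (w', z'))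
    · simpa [WithLp.prod_inner_apply, triple] using h q.fst q.snd
  rw [hmem, ← support_subgradient_iff (fun z => (hS z).2)]
  constructor
  · rintro ⟨h1, h2⟩
    have hw : ∃ h, mulV Q h = w := by
      by_contra hw
      have := h1 0 0
      rw [hout _ _ _ hw, hin 0 0 x ⟨0, map_zero _⟩, EReal.top_add_coe, top_le_iff] at this
      exact EReal.coe_ne_top _ this
    obtain ⟨h, rfl⟩ := hw
    set w := mulV Q h
    refine ⟨⟨h, rfl⟩, ?_, fun z' => ?_, ?_⟩
    · set e := mulV Q w - mulV Q x - uw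
      -- Stationarity in `w` is tested along the direction `-Q (Q e)` of the range of `Q`.
      have h3 : ⟪e, mulV Q (mulV Q e)⟫_ℝ ≤ 0 := by
        set k := mulV Q (mulV Q e)
        refine nonpos_of_forall_le_mul (β := 1 / 2 * ⟪k, mulV Q k⟫_ℝ) fun t ht _ => ?_
        have h4 := h1 (w + (-t) • k) z
        rw [hin _ _ _ ⟨h, rfl⟩, hin _ _ _ ⟨h + (-t) • mulV Q e, by simp [w, k]⟩,
          ← EReal.coe_add, EReal.coe_le_coe_iff, inner_mulV_add_smul hQ] at h4
        simp only [map_add, map_smul, inner_add_right, inner_smul_right, sub_self,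
          inner_zero_right, add_sub_cancel_left, ← inner_mulV_comm hQ x k] at h4
        have h5 : ⟪e, k⟫_ℝ = ⟪mulV Q w, k⟫_ℝ - ⟪mulV Q x, k⟫_ℝ - ⟪uw, k⟫_ℝ := by
          simp only [e, inner_sub_left]
        rw [h5]
        refine le_of_mul_le_mul_left ?_ ht
        linarith
      rw [← inner_mulV_comm hQ] at h3
      exact real_inner_self_nonpos.1 h3
    · have h4 := h1 w z'
      rw [hin _ _ _ ⟨h, rfl⟩, hin _ _ _ ⟨h, rfl⟩, ← EReal.coe_add, EReal.coe_le_coe_iff] at h4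
      simp only [inner_add_right, inner_sub_right] at h4
      simp only [inner_add_left, inner_sub_right]
      linarith
    · -- The Lagrangian is affine in `x`, so its only supergradient is its slope.
      set g := mulV Q w + z + c
      have h4 := h2 (x + (ux - g))
      rw [hin _ _ _ ⟨h, rfl⟩, hin _ _ _ ⟨h, rfl⟩, ← EReal.coe_add, EReal.coe_le_coe_iff,
        add_sub_cancel_left, inner_add_left, inner_neg_left] at h4
      have h5 : ⟪ux - g, ux - g⟫_ℝ ≤ 0 := by
        rw [inner_sub_left ux g (ux - g), real_inner_comm (ux - g) g]
        linarith
      exact (sub_eq_zero.1 (real_inner_self_nonpos.1 h5)).symm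
  · rintro ⟨hw, h1, h2, rfl⟩
    refine ⟨fun w' z' => ?_, fun x' => ?_⟩
    · by_cases hw' : ∃ h, mulV Q h = w'
      · rw [hin _ _ _ hw, hin _ _ _ hw', ← EReal.coe_add, EReal.coe_le_coe_iff]
        have h3 := inner_mulV_add_smul hQ w (w' - w) 1
        have h4 := inner_mulV_nonneg hQ (w' - w)
        have h5 := h2 z'
        have h6 : ⟪mulV Q w - mulV Q x - uw, w' - w⟫_ℝ = 0 := by
          obtain ⟨h, rfl⟩ := hw
          obtain ⟨h', rfl⟩ := hw'
          rw [← map_sub (mulV Q) h' h, ← inner_mulV_comm hQ, h1, inner_zero_left]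
        rw [one_smul, add_sub_cancel] at h3
        simp only [inner_sub_left, inner_mulV_comm hQ x, map_sub] at h6
        simp only [inner_add_left, inner_sub_right] at h5 h6
        simp only [inner_add_right, inner_sub_right] at h6 ⊢
        simp only [inner_sub_right] at h3
        linarith
      · rw [hout _ _ _ hw']
        exact le_top
    · rw [hin _ _ _ hw, hin _ _ _ hw, ← EReal.coe_add, EReal.coe_le_coe_iff, inner_neg_left,
        inner_sub_right, real_inner_comm _ x', real_inner_comm _ x]
      linarith

end Operators

/-! ### Local error bounds for the two operators -/

section ErrorBounds

variable {n : ℕ} {Q : Matrix (Fin n) (Fin n) ℝ}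

lemma convex_box_inter_hyperplane (lo hi a : Vec n) (d : ℝ) :
    Convex ℝ (box lo hi ∩ hyperplane a d) := by
  refine Convex.inter ?_ ?_
  · intro x hx y hy s t hs ht hst i
    have hlo := convex_Ici (𝕜 := ℝ) (lo i) (hx i).1 (hy i).1 hs ht hst
    have hhi := convex_Iic (𝕜 := ℝ) (hi i) (hx i).2 (hy i).2 hs ht hst
    exact ⟨by simpa using hlo, by simpa using hhi⟩
  · intro x hx y hy s t hs ht hst
    have hx : ⟪a, x⟫_ℝ = d := hx
    have hy : ⟪a, y⟫_ℝ = d := hy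
    change ⟪a, s • x + t • y⟫_ℝ = d
    rw [inner_add_right, inner_smul_right, inner_smul_right, hx, hy, ← add_mul, hst, one_mul]

/-- When the feasible set is empty the objective is constantly `+∞`, and every point is critical. -/
lemma mem_Tf_of_empty (c x v : Vec n) : v ∈ Tf Q c ∅ x := by
  intro y
  simp only [objective, indicatorFun, Set.mem_empty_iff_false, if_false]
  rw [EReal.coe_add_top]
  exact le_top

/-- When the feasible set is empty the Lagrangian is `-∞` over the range of `Q`, so the values of
`Tl` are either empty or the whole space. -/
lemma mem_Tl_of_empty {c : Vec n} {p v : Vec3 n} (hv : v ∈ Tl Q c ∅ p) (u : Vec3 n) :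
    u ∈ Tl Q c ∅ p := by
  have hconj : ∀ z : Vec n, conjugate (indicatorFun ∅) z = ⊥ := fun z => by
    simp [conjugate, indicatorFun]
  have hbot : ∀ w z x : Vec n, w ∈ LinearMap.range (mulV Q) → lagrangian Q c ∅ w z x = ⊥ :=
    fun w z x hw => by
      rw [lagrangian, if_pos hw, hconj, EReal.add_bot, EReal.bot_sub]
  have hw : p.fst.fst ∈ LinearMap.range (mulV Q) := by
    by_contra hw
    have h := hv.1 0
    change lagrangian Q c ∅ p.fst.fst p.fst.snd p.snd + _ ≤ lagrangian Q c ∅ 0 0 p.snd at h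
    rw [hbot 0 0 _ (Submodule.zero_mem _), lagrangian, if_neg hw, EReal.top_add_coe,
      top_le_iff] at h
    exact bot_ne_top h
  refine ⟨fun q => ?_, fun y => ?_⟩
  · simp only [hbot _ _ _ hw, EReal.bot_add, bot_le]
  · simp only [hbot _ _ _ hw, bot_le]

lemma mem_setInv_iff {X Y : Type*} {F : X → Set Y} {x : X} {y : Y} :
    x ∈ setInv F y ↔ y ∈ F x := Iff.rfl

/-- Error bound for the primal operator at points with a small subgradient. -/
lemma exists_local_bound_Tf (hQ : Q.PosSemidef) (c lo hi a : Vec n) (d : ℝ) :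
    ∃ K : ℝ, ∃ ε > 0, ∀ x v, v ∈ Tf Q c (box lo hi ∩ hyperplane a d) x → ‖v‖ ≤ ε →
      ∃ x' ∈ setInv (Tf Q c (box lo hi ∩ hyperplane a d)) 0, ‖x - x'‖ ≤ K * ‖v‖ := by
  rcases (box lo hi ∩ hyperplane a d).eq_empty_or_nonempty with hne | hne
  · rw [hne]
    exact ⟨0, 1, one_pos, fun x v _ _ => ⟨x, mem_setInv_iff.2 (mem_Tf_of_empty c x 0), by simp⟩⟩
  have hTf := mem_Tf_iff hQ c (convex_box_inter_hyperplane lo hi a d) hne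
  -- The graph of `Tf`, with the multiplier as an additional variable, is a finite union of
  -- polyhedral sets.
  have hpoly : ∀ σ : Fin n → SignType, IsPolyhedral {q : (Vec n × ℝ) × Vec n |
      (q.1.1, q.2 - mulV Q q.1.1 - c, q.1.2) ∈ normalPiece lo hi a d σ} := by
    intro σ
    let X : ((Vec n × ℝ) × Vec n) →ₗ[ℝ] Vec n := LinearMap.fst ℝ _ _ ∘ₗ LinearMap.fst ℝ _ _
    let M : ((Vec n × ℝ) × Vec n) →ₗ[ℝ] ℝ := LinearMap.snd ℝ _ _ ∘ₗ LinearMap.fst ℝ _ _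
    convert (isPolyhedral_normalPiece lo hi a d σ).preimage
      (X.prod ((LinearMap.snd ℝ _ _ - mulV Q ∘ₗ X).prod M)) (0, -c, 0) using 3 with q
    simp [X, M, sub_eq_add_neg]
  obtain ⟨K, ε, hε, hK⟩ := exists_fiber_bound_of_forall_isPolyhedral hpoly
  refine ⟨K, ε, hε, fun x v hv hvε => ?_⟩
  obtain ⟨σ, μ, hq⟩ := mem_normalCone_iff.1 ((hTf x v).1 hv)
  obtain ⟨⟨x', μ'⟩, hq', hle⟩ := hK σ (x, μ) v hq hvε
  exact ⟨x', mem_setInv_iff.2 <| (hTf x' 0).2 (mem_normalCone_iff.2 ⟨σ, μ', hq'⟩),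
    (norm_fst_le _).trans hle⟩

/-- Error bound for the saddle operator at points with a small residual. -/
lemma exists_local_bound_Tl (hQ : Q.PosSemidef) (c lo hi a : Vec n) (d : ℝ) :
    ∃ K : ℝ, ∃ ε > 0, ∀ p v, v ∈ Tl Q c (box lo hi ∩ hyperplane a d) p → ‖v‖ ≤ ε →
      ∃ p' ∈ setInv (Tl Q c (box lo hi ∩ hyperplane a d)) 0, ‖p - p'‖ ≤ K * ‖v‖ := by
  rcases (box lo hi ∩ hyperplane a d).eq_empty_or_nonempty with hne | hne
  · rw [hne]
    exact ⟨0, 1, one_pos, fun p v hv _ => ⟨p, mem_setInv_iff.2 (mem_Tl_of_empty hv 0), by simp⟩⟩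
  have hTl := mem_Tl_iff hQ c hne
  -- The additional variables are a preimage of `w` under `Q` and the multiplier.
  have hpoly : ∀ σ : Fin n → SignType, IsPolyhedral {q : (Vec3 n × Vec n × ℝ) × Vec3 n |
      mulV Q q.1.2.1 - q.1.1.fst.fst = 0 ∧
      mulV Q (mulV Q q.1.1.fst.fst - mulV Q q.1.1.snd - q.2.fst.fst) = 0 ∧
      (q.2.fst.snd + q.1.1.snd, q.1.1.fst.snd, q.1.2.2) ∈ normalPiece lo hi a d σ ∧
      mulV Q q.1.1.fst.fst + q.1.1.fst.snd - q.2.snd = -c} := by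
    intro σ
    let W : Vec3 n →ₗ[ℝ] Vec n := WithLp.fstₗ 2 ℝ _ _ ∘ₗ WithLp.fstₗ 2 ℝ _ _
    let Z : Vec3 n →ₗ[ℝ] Vec n := WithLp.sndₗ 2 ℝ _ _ ∘ₗ WithLp.fstₗ 2 ℝ _ _
    let X : Vec3 n →ₗ[ℝ] Vec n := WithLp.sndₗ 2 ℝ _ _
    let P : ((Vec3 n × Vec n × ℝ) × Vec3 n) →ₗ[ℝ] Vec3 n :=
      LinearMap.fst ℝ _ _ ∘ₗ LinearMap.fst ℝ _ _
    let U : ((Vec3 n × Vec n × ℝ) × Vec3 n) →ₗ[ℝ] Vec3 n := LinearMap.snd ℝ _ _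
    let H : ((Vec3 n × Vec n × ℝ) × Vec3 n) →ₗ[ℝ] Vec n :=
      LinearMap.fst ℝ _ _ ∘ₗ LinearMap.snd ℝ _ _ ∘ₗ LinearMap.fst ℝ _ _
    let M : ((Vec3 n × Vec n × ℝ) × Vec3 n) →ₗ[ℝ] ℝ :=
      LinearMap.snd ℝ _ _ ∘ₗ LinearMap.snd ℝ _ _ ∘ₗ LinearMap.fst ℝ _ _
    refine (isPolyhedral_eq_vec (mulV Q ∘ₗ H - W ∘ₗ P) 0).and
      ((isPolyhedral_eq_vec (mulV Q ∘ₗ (mulV Q ∘ₗ W ∘ₗ P - mulV Q ∘ₗ X ∘ₗ P - W ∘ₗ U)) 0).and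
        (IsPolyhedral.and ?_ (isPolyhedral_eq_vec (mulV Q ∘ₗ W ∘ₗ P + Z ∘ₗ P - X ∘ₗ U) (-c))))
    convert (isPolyhedral_normalPiece lo hi a d σ).preimage
      ((Z ∘ₗ U + X ∘ₗ P).prod ((Z ∘ₗ P).prod M)) 0 using 3 with q
    rw [add_zero]
    rfl
  obtain ⟨K, ε, hε, hK⟩ := exists_fiber_bound_of_forall_isPolyhedral hpoly
  refine ⟨K, ε, hε, fun p v hv hvε => ?_⟩
  obtain ⟨⟨h, hw⟩, h1, h2, h3⟩ := (hTl p.fst.fst p.fst.snd p.snd v.fst.fst v.fst.snd v.snd).1 hv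
  obtain ⟨σ, μ, hq⟩ := mem_normalCone_iff.1 h2
  obtain ⟨⟨p', h', μ'⟩, ⟨hw', h1', hq', h3'⟩, hle⟩ := hK σ (p, h, μ) v
    ⟨sub_eq_zero.2 hw, h1, hq, by rw [← h3]; abel⟩ hvε
  refine ⟨p', ?_, (norm_fst_le _).trans hle⟩
  refine mem_setInv_iff.2 <| (hTl p'.fst.fst p'.fst.snd p'.snd 0 0 0).2
    ⟨⟨h', sub_eq_zero.1 hw'⟩, h1', mem_normalCone_iff.2 ⟨σ, μ', hq'⟩, ?_⟩
  have h4 : mulV Q p'.fst.fst + p'.fst.snd - 0 = -c := h3'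
  rw [sub_zero] at h4
  rw [h4, neg_add_cancel]

end ErrorBounds

end SVMDual

theorem mainTheorem5 (n : ℕ) (Q : Matrix (Fin n) (Fin n) ℝ) (hQ : Q.PosSemidef)
    (c a lo hi : SVMDual.Vec n) (d : ℝ) (hlohi : ∀ i, lo i < hi i)
    (C : Set (SVMDual.Vec n)) (hC : C = SVMDual.box lo hi ∩ SVMDual.hyperplane a d) :
    ∀ r : ℝ, 0 < r → ∃ κf : ℝ, 0 < κf ∧ ∃ κl : ℝ, 0 < κl ∧
      (∀ x : SVMDual.Vec n,
        Metric.infEDist x (SVMDual.setInv (SVMDual.Tf Q c C) 0) ≤ ENNReal.ofReal r →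
        Metric.infEDist x (SVMDual.setInv (SVMDual.Tf Q c C) 0) ≤
          ENNReal.ofReal κf * Metric.infEDist 0 (SVMDual.Tf Q c C x)) ∧
      (∀ wbar zbar xbar : SVMDual.Vec n,
        SVMDual.triple wbar zbar xbar ∈ SVMDual.setInv (SVMDual.Tl Q c C) 0 →
        ∀ w z x : SVMDual.Vec n,
          ‖SVMDual.triple w z x - SVMDual.triple wbar zbar xbar‖ ≤ r →
          Metric.infEDist (SVMDual.triple w z x) (SVMDual.setInv (SVMDual.Tl Q c C) 0) ≤
            ENNReal.ofReal κl *
              Metric.infEDist 0 (SVMDual.Tl Q c C (SVMDual.triple w z x))) := by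
  subst hC
  intro r hr
  obtain ⟨K₁, ε₁, hε₁, h₁⟩ := SVMDual.exists_local_bound_Tf hQ c lo hi a d
  obtain ⟨K₂, ε₂, hε₂, h₂⟩ := SVMDual.exists_local_bound_Tl hQ c lo hi a d
  obtain ⟨κf, hκf, hf⟩ := SVMDual.exists_bound_of_local_bound hε₁ h₁ hr
  obtain ⟨κl, hκl, hl⟩ := SVMDual.exists_bound_of_local_bound hε₂ h₂ hr
  refine ⟨κf, hκf, κl, hκl, hf, fun wbar zbar xbar hbar w z x hle => hl _ ?_⟩
  refine (Metric.infEDist_le_edist_of_mem hbar).trans ?_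
  rw [edist_dist, dist_eq_norm]
  exact ENNReal.ofReal_le_ofReal hle
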